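/- Let $\chi$ be a non-principal primitive Dirichlet character of odd modulus $k$, with complex conjugate $\bar\chi$, let $p\ge 1$ be an integer, and let $c,d$ be coprime positive integers with $d$ even. Let $B_n(x)$ and $E_n(x)$ be the Bernoulli and Euler polynomials. Let $\mathfrak B_n$ be the $1$-periodic function that equals $B_n$ on $[0,1)$, except that $\mathfrak B_1(m)=0$ for $m\in\mathbb Z$; let $\mathcal E_n$ be the function with $\mathcal E_n=E_n$ on $[0,1)$ and $\mathcal E_n(x+m)=(-1)^m\mathcal E_n(x)$ for $m\in\mathbb Z$. Put $$\mathfrak B_{m,\chi}(x)=k^{m-1}\sum_{j=0}^{k-1}\bar\chi(j)\,\mathfrak B_m\Big(\frac{j+x}{k}\Big)\ (m\ge1),\qquad \mathcal E_{m,\chi}(x)=k^{m}\sum_{j=0}^{k-1}(-1)^j\bar\chi(j)\,\mathcal E_m\Big(\frac{j+x}{k}\Big)\ (m\ge 0),$$ and, for integers $c>0$ and $d$ (of either sign) and $z\in\mathbb C$, $$g_1(c,d,z,p,\chi)=\sum_{m=1}^{p}\binom pm k^{m-p}\big(-(cz+d)\big)^{m-1}\sum_{n=1}^{ck}\chi(n)\,\mathcal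 E_{p-m,\chi}\Big(\frac{dn}{c}\Big)\mathfrak B_m\Big(\frac{n}{ck}\Big),$$ $$g_2(c,d,z,p,\chi)=\sum_{m=1}^{p}\binom{p+1}m k^{m-p}\big(-(cz+d)\big)^{m-1}\sum_{n=1}^{ck}(-1)^n\chi(n)\,\mathfrak B_{p+1-m,\chi}\Big(\frac{dn}{c}\Big)\mathfrak B_m\Big(\frac{n}{ck}\Big).$$ If $d\equiv 0\pmod k$ or $c\equiv0\pmod k$, then for every complex $z\ne0$ $$\frac{p+1}{2}\,z^{p-1}g_1\Big(c,d,-\frac1z,p,\bar\chi\Big)+\chi(-1)\,g_2(d,-c,z,p,\chi)=-\frac{\chi(-1)}{k^{p-1}}\sum_{m=1}^{p}\binom{p+1}{m}\frac m2(-z)^{m-1}\,\mathfrak B_{p+1-m,\chi}(0)\,\mathcal E_{m-1,\bar\chi}(0).$$ Moreover $z^{p-1}g_1(c,d,-1/z,p,\bar\chi)$ is, for $z\neq0$, the value of a polynomial in $z$, and with this polynomial in its place the identity holds for all $z\in\mathbb C$, including $z=0$. -/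

import Mathlib

noncomputable section

namespace CharHardyBerndt

/-- The value `E_n(x)` of the `n`-th Euler polynomial, read off from the generating function
`2 e^{xt} / (e^t + 1) = ∑ E_n(x) t^n / n!`. -/
def eulerPoly (n : ℕ) (x : ℝ) : ℝ :=
  (n.factorial : ℝ) * PowerSeries.coeff n
    (2 * PowerSeries.rescale x (PowerSeries.exp ℝ) * (PowerSeries.exp ℝ + 1)⁻¹)

theorem eulerPoly_generating (x : ℝ) :
    PowerSeries.mk (fun n => eulerPoly n x / (n.factorial : ℝ)) * (PowerSeries.exp ℝ + 1) =
      2 * PowerSeries.rescale x (PowerSeries.exp ℝ) := by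
  have h : PowerSeries.mk (fun n => eulerPoly n x / (n.factorial : ℝ)) =
      2 * PowerSeries.rescale x (PowerSeries.exp ℝ) * (PowerSeries.exp ℝ + 1)⁻¹ := by
    ext n
    have hn : (n.factorial : ℝ) ≠ 0 := by exact_mod_cast n.factorial_ne_zero
    rw [PowerSeries.coeff_mk, eulerPoly, mul_div_cancel_left₀ _ hn]
  rw [h, mul_assoc, PowerSeries.inv_mul_cancel, mul_one]
  have h1 : PowerSeries.constantCoeff (PowerSeries.exp ℝ + 1) = (1 : ℝ) + 1 := by simp
  rw [h1]
  norm_num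

/-- The Bernoulli function `𝔅_n(x)`: the 1-periodic extension of `B_n` from `[0, 1)`, with
`𝔅_1` set to `0` at the integers. Mathlib's `bernoulliFun n` is the Bernoulli polynomial. -/
def periodicB (n : ℕ) (x : ℝ) : ℝ :=
  if n = 1 ∧ Int.fract x = 0 then 0 else bernoulliFun n (Int.fract x)

/-- The Euler function `𝓔_n(x)`: equal to `E_n` on `[0, 1)` and antiperiodic with
`𝓔_n(x + m) = (-1)^m 𝓔_n(x)`. -/
def periodicE (n : ℕ) (x : ℝ) : ℝ :=
  (-1) ^ ⌊x⌋ * eulerPoly n (Int.fract x)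

/-- The generalized Bernoulli function
`𝔅_{m,χ}(x) = k^{m-1} ∑_{j=0}^{k-1} χ̄(j) 𝔅_m((j + x) / k)`. -/
def charB {k : ℕ} (m : ℕ) (χ : DirichletCharacter ℂ k) (x : ℝ) : ℂ :=
  (k : ℂ) ^ ((m : ℤ) - 1) *
    ∑ j ∈ Finset.range k, (star χ) (j : ZMod k) * (periodicB m (((j : ℝ) + x) / k) : ℂ)

/-- The character Euler function
`𝓔_{m,χ}(x) = k^m ∑_{j=0}^{k-1} (-1)^j χ̄(j) 𝓔_m((j + x) / k)`, for odd `k`. -/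
def charE {k : ℕ} (m : ℕ) (χ : DirichletCharacter ℂ k) (x : ℝ) : ℂ :=
  (k : ℂ) ^ m *
    ∑ j ∈ Finset.range k,
      (-1) ^ j * (star χ) (j : ZMod k) * (periodicE m (((j : ℝ) + x) / k) : ℂ)

/-- `g₁(c,d,z,p,χ) = ∑_{m=1}^p C(p,m) k^{m-p} (-(cz+d))^{m-1}
  ∑_{n=1}^{ck} χ(n) 𝓔_{p-m,χ}(dn/c) 𝔅_m(n/(ck))`, for `c > 0`. -/
def g₁ {k : ℕ} (c : ℕ) (d : ℤ) (z : ℂ) (p : ℕ) (χ : DirichletCharacter ℂ k) : ℂ :=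
  ∑ m ∈ Finset.Icc 1 p,
    (p.choose m : ℂ) * (k : ℂ) ^ ((m : ℤ) - p) * (-((c : ℂ) * z + d)) ^ (m - 1) *
      ∑ n ∈ Finset.Icc 1 (c * k),
        χ (n : ZMod k) * charE (p - m) χ ((d : ℝ) * n / c) *
          (periodicB m ((n : ℝ) / ((c : ℝ) * k)) : ℂ)

/-- `g₂(c,d,z,p,χ) = ∑_{m=1}^p C(p+1,m) (-(cz+d))^{m-1} k^{m-p}
  ∑_{n=1}^{ck} (-1)^n χ(n) 𝔅_{p+1-m,χ}(dn/c) 𝔅_m(n/(ck))`, for `c > 0`. -/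
def g₂ {k : ℕ} (c : ℕ) (d : ℤ) (z : ℂ) (p : ℕ) (χ : DirichletCharacter ℂ k) : ℂ :=
  ∑ m ∈ Finset.Icc 1 p,
    ((p + 1).choose m : ℂ) * (-((c : ℂ) * z + d)) ^ (m - 1) * (k : ℂ) ^ ((m : ℤ) - p) *
      ∑ n ∈ Finset.Icc 1 (c * k),
        (-1) ^ n * χ (n : ZMod k) * charB (p + 1 - m) χ ((d : ℝ) * n / c) *
          (periodicB m ((n : ℝ) / ((c : ℝ) * k)) : ℂ)

/-- The right-hand side of the reciprocity relation:
`-χ(-1) k^{-(p-1)} ∑_{m=1}^p C(p+1,m) (m/2) (-z)^{m-1} 𝔅_{p+1-m,χ}(0) 𝓔_{m-1,χ̄}(0)`. -/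
def reciprocityRHS {k : ℕ} (z : ℂ) (p : ℕ) (χ : DirichletCharacter ℂ k) : ℂ :=
  -(χ (-1) / (k : ℂ) ^ (p - 1)) *
    ∑ m ∈ Finset.Icc 1 p,
      ((p + 1).choose m : ℂ) * ((m : ℂ) / 2) * (-z) ^ (m - 1) *
        charB (p + 1 - m) χ 0 * charE (m - 1) (star χ) 0

end CharHardyBerndt

end

/-! The identity is a character-weighted sum of a three-term relation for Bernoulli series. Write
B(x;U) = ∑ B_n(x)(Ut)^n/n! = Ut·e^{xUt}/(e^{Ut}-1). If P = Q + D, then D·B(x;P)B(y-x;Q) +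
Q·B(y;P)B(y-x;-D) = P·B(x;D)B(y;Q), because clearing denominators leaves only e^{Pt} = e^{Qt}e^{Dt}
(`bernoulliSeries_three_term`).

Take x = n/(dk), y = l/(ck), P = c-dz, Q = c, D = -dz, compare coefficients of t^{p+1}, and sum over
n mod dk and l mod ck with weight (-1)^n χ(n) χ̄(l). In the first product the sum over l is a
distribution relation producing 𝔅_{·,χ} (`charB_eq_sum`), which gives g₂. In the second, the sum
over n is an alternating distribution relation, valid since d is even, producing 𝓔_{·,χ̄}
(`charE_eq_sum`), which gives g₁. The third product splits into both kinds at 0, which gives the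
right-hand side.

The condition k ∣ d or k ∣ c enters twice. It keeps y-x off the integers wherever the weight is
nonzero, so the convention 𝔅_1(m) = 0 never interferes, and it kills the end terms containing only
𝔅_{p+1}(y-x) (`double_character_sum_eq_zero`). The values z = 0 and z = c/d, where D or P vanishes,
follow by continuity. -/

namespace CharHardyBerndt

/-! ### Bernoulli generating series and the three-term relation -/

/-- The exponential generating series `∑ B_n(x) U^n t^n / n!` of the Bernoulli polynomials. -/
noncomputable def bernoulliSeries (x : ℝ) (U : ℂ) : PowerSeries ℂ :=
  PowerSeries.mk fun n => (bernoulliFun n x : ℂ) * U ^ n / (n.factorial : ℂ)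

/-- The power series of `e^{Ut}`. -/
noncomputable def expSeries (U : ℂ) : PowerSeries ℂ :=
  PowerSeries.rescale U (PowerSeries.exp ℂ)

theorem expSeries_add (U V : ℂ) : expSeries (U + V) = expSeries U * expSeries V :=
  (PowerSeries.exp_mul_exp_eq_exp_add U V).symm

theorem expSeries_zero : expSeries 0 = 1 := by
  simp [expSeries]

theorem expSeries_pow (U : ℂ) (n : ℕ) : expSeries U ^ n = expSeries (n * U) := by
  induction n with
  | zero => simp [expSeries_zero]
  | succ n ih =>
    rw [pow_succ, ih, ← expSeries_add]
    congr 1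
    push_cast
    ring

theorem expSeries_sub_one_ne_zero {U : ℂ} (hU : U ≠ 0) : expSeries U - 1 ≠ 0 := by
  intro h
  have := congrArg (PowerSeries.coeff 1) h
  simp [expSeries, PowerSeries.coeff_rescale, PowerSeries.coeff_exp, PowerSeries.coeff_one] at this
  exact hU this

theorem bernoulliSeries_mul (x : ℝ) (U : ℂ) :
    bernoulliSeries x U * (expSeries U - 1) =
      PowerSeries.C U * PowerSeries.X * expSeries (x * U) := by
  have h := congrArg (PowerSeries.rescale U) (Polynomial.bernoulli_generating_function (x : ℂ))
  rw [map_mul, map_mul, map_sub, map_one, PowerSeries.rescale_X, PowerSeries.rescale_rescale] at h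
  rw [expSeries, expSeries, ← h]
  congr 1
  ext n
  rw [bernoulliSeries, PowerSeries.coeff_mk, PowerSeries.coeff_rescale, PowerSeries.coeff_mk,
    map_smul, bernoulliFun]
  have : Polynomial.aeval (x : ℂ) (Polynomial.bernoulli n) =
      ((Polynomial.eval x (Polynomial.map (algebraMap ℚ ℝ) (Polynomial.bernoulli n)) : ℝ) : ℂ) := by
    rw [Polynomial.eval_map_algebraMap]
    exact Polynomial.aeval_algebraMap_apply ℂ x _
  rw [this, Algebra.smul_def]
  simp
  ring

/-- The reflection B_n(1-x) = (-1)^n B_n(x) at the level of series; it handles the parameter -D in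
the three-term relation. -/
theorem bernoulliSeries_neg_mul (x : ℝ) (U : ℂ) :
    bernoulliSeries x (-U) * (expSeries U - 1) =
      PowerSeries.C U * PowerSeries.X * expSeries ((1 - x) * U) := by
  have h := bernoulliSeries_mul x (-U)
  have h1 : expSeries U * expSeries (-U) = 1 := by
    rw [← expSeries_add, add_neg_cancel, expSeries_zero]
  have h2 : expSeries ((1 - x) * U) = expSeries U * expSeries (x * -U) := by
    rw [← expSeries_add]; congr 1; ring
  rw [h2]
  rw [map_neg] at h
  linear_combination (-expSeries U) * h + bernoulliSeries x (-U) * h1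

/-- The three-term relation for products of Bernoulli generating series. -/
theorem bernoulliSeries_three_term {x y r : ℝ} {P Q D : ℂ} (hP : P ≠ 0) (hQ : Q ≠ 0) (hD : D ≠ 0)
    (hPQD : P = Q + D) (hr : r = y - x ∨ r = y - x + 1) :
    PowerSeries.C D * (bernoulliSeries x P * bernoulliSeries r Q) +
        PowerSeries.C Q * (bernoulliSeries y P * bernoulliSeries r (-D)) =
      PowerSeries.C P * (bernoulliSeries x D * bernoulliSeries y Q) := by
  have hne := mul_ne_zero (mul_ne_zero (expSeries_sub_one_ne_zero hP)
    (expSeries_sub_one_ne_zero hQ)) (expSeries_sub_one_ne_zero hD)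
  apply mul_right_cancel₀ hne
  have h1 := bernoulliSeries_mul x P
  have h2 := bernoulliSeries_mul r Q
  have h3 := bernoulliSeries_mul y P
  have h4 := bernoulliSeries_neg_mul r D
  have h5 := bernoulliSeries_mul x D
  have h6 := bernoulliSeries_mul y Q
  have hE : expSeries P = expSeries Q * expSeries D := by rw [hPQD, expSeries_add]
  set p := expSeries P
  set q := expSeries Q
  set d := expSeries D
  -- With all denominators cleared, a common exponential factors out. What remains is (d-1) + d(q-1)
  -- = qd-1 or q(d-1) + (q-1) = qd-1, according to the value of r.
  have key : expSeries (x * P) * expSeries (r * Q) * (d - 1) +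
      expSeries (y * P) * expSeries ((1 - r) * D) * (q - 1) =
      expSeries (x * D) * expSeries (y * Q) * (p - 1) := by
    rw [← expSeries_add, ← expSeries_add, ← expSeries_add]
    rcases hr with hr | hr
    · have e1 : (x * P + r * Q : ℂ) = x * D + y * Q := by
        rw [hr, hPQD]; push_cast; ring
      have e2 : (y * P + (1 - r) * D : ℂ) = (x * D + y * Q) + D := by
        rw [hr, hPQD]; push_cast; ring
      rw [e1, e2, expSeries_add _ D, hE]
      ring
    · have e1 : (x * P + r * Q : ℂ) = (x * D + y * Q) + Q := by
        rw [hr, hPQD]; push_cast; ring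
      have e2 : (y * P + (1 - r) * D : ℂ) = x * D + y * Q := by
        rw [hr, hPQD]; push_cast; ring
      rw [e1, e2, expSeries_add _ Q, hE]
      ring
  calc _ = PowerSeries.C D * (d - 1) * ((bernoulliSeries x P * (p - 1)) *
            (bernoulliSeries r Q * (q - 1))) +
          PowerSeries.C Q * (q - 1) * ((bernoulliSeries y P * (p - 1)) *
            (bernoulliSeries r (-D) * (d - 1))) := by ring
    _ = PowerSeries.C P * (p - 1) * ((bernoulliSeries x D * (d - 1)) *
            (bernoulliSeries y Q * (q - 1))) := by
        rw [h1, h2, h3, h4, h5, h6]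
        linear_combination PowerSeries.C P * PowerSeries.C Q * PowerSeries.C D *
          PowerSeries.X ^ 2 * key
    _ = _ := by ring

theorem factorial_mul_coeff_bernoulliSeries_mul (x y : ℝ) (U V : ℂ) (N : ℕ) :
    (N.factorial : ℂ) * PowerSeries.coeff N (bernoulliSeries x U * bernoulliSeries y V) =
      ∑ m ∈ Finset.range (N + 1), (N.choose m : ℂ) *
        ((bernoulliFun m x : ℂ) * U ^ m * ((bernoulliFun (N - m) y : ℂ) * V ^ (N - m))) := by
  rw [PowerSeries.coeff_mul, Finset.Nat.sum_antidiagonal_eq_sum_range_succ_mk, Finset.mul_sum]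
  refine Finset.sum_congr rfl fun m hm => ?_
  have hm' : m ≤ N := Nat.lt_succ_iff.mp (Finset.mem_range.mp hm)
  rw [Nat.cast_choose ℂ hm', bernoulliSeries, bernoulliSeries, PowerSeries.coeff_mk,
    PowerSeries.coeff_mk]
  ring

theorem periodicB_of_fract_ne_zero {x : ℝ} (hx : Int.fract x ≠ 0) (n : ℕ) :
    periodicB n x = bernoulliFun n (Int.fract x) := by
  simp [periodicB, hx]

/-- Non-integrality lets every periodic function be read as a polynomial at a fractional part. The
fractional part of y-x may wrap around once, which is why the series relation allows two values of
r. -/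
theorem periodicB_three_term {x y : ℝ} (hx : Int.fract x ≠ 0) (hy : Int.fract y ≠ 0)
    (hxy : Int.fract (y - x) ≠ 0) {P Q D : ℂ} (hP : P ≠ 0) (hQ : Q ≠ 0) (hD : D ≠ 0)
    (hPQD : P = Q + D) (N : ℕ) :
    D * ∑ m ∈ Finset.range (N + 1), (N.choose m : ℂ) *
        ((periodicB m x : ℂ) * P ^ m * ((periodicB (N - m) (y - x) : ℂ) * Q ^ (N - m))) +
      Q * ∑ m ∈ Finset.range (N + 1), (N.choose m : ℂ) *
        ((periodicB m y : ℂ) * P ^ m * ((periodicB (N - m) (y - x) : ℂ) * (-D) ^ (N - m))) =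
      P * ∑ m ∈ Finset.range (N + 1), (N.choose m : ℂ) *
        ((periodicB m x : ℂ) * D ^ m * ((periodicB (N - m) y : ℂ) * Q ^ (N - m))) := by
  simp only [periodicB_of_fract_ne_zero hx, periodicB_of_fract_ne_zero hy,
    periodicB_of_fract_ne_zero hxy]
  have hr : Int.fract (y - x) = Int.fract y - Int.fract x ∨
      Int.fract (y - x) = Int.fract y - Int.fract x + 1 := by
    rcases le_or_gt (Int.fract x) (Int.fract y) with h | h
    · left
      rw [Int.fract_eq_iff]
      refine ⟨by linarith, by linarith [Int.fract_lt_one y, Int.fract_nonneg x],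
        ⌊y⌋ - ⌊x⌋, ?_⟩
      simp only [Int.fract]; push_cast; ring
    · right
      rw [Int.fract_eq_iff]
      refine ⟨by linarith [Int.fract_lt_one x, Int.fract_nonneg y], by linarith,
        ⌊y⌋ - ⌊x⌋ - 1, ?_⟩
      simp only [Int.fract]; push_cast; ring
  have h := congrArg (fun s => (N.factorial : ℂ) * PowerSeries.coeff N s)
    (bernoulliSeries_three_term hP hQ hD hPQD hr)
  simp only [map_add, PowerSeries.coeff_C_mul] at h
  simp only [← factorial_mul_coeff_bernoulliSeries_mul]
  linear_combination h

/-! ### Distribution relations, plain and alternating -/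

theorem bernoulliFun_sum_div (M : ℕ) {c : ℕ} (hc : c ≠ 0) (t : ℝ) :
    (c : ℝ) ^ M * ∑ i ∈ Finset.range c, bernoulliFun M ((t + i) / c) = c * bernoulliFun M t := by
  have hc' : (c : ℝ) ≠ 0 := Nat.cast_ne_zero.mpr hc
  have h := bernoulliFun_mul M hc (t / c)
  rw [mul_div_cancel₀ _ hc'] at h
  rw [h]
  simp only [add_div]
  field_simp

/-- On generating series the left side contains the geometric sum of powers of -e^t. For even d this
sum equals -(e^{dt}-1)/(e^t+1): the numerator cancels the Bernoulli denominator and the Euler series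
remains. -/
theorem alternating_bernoulliFun_sum_div (M : ℕ) {d : ℕ} (hd : d ≠ 0) (hd2 : Even d) (t : ℝ) :
    (d : ℝ) ^ M * ∑ i ∈ Finset.range d, (-1) ^ i * bernoulliFun M ((t + i) / d) =
      -(d / 2) * M * eulerPoly (M - 1) t := by
  have hdC : (d : ℂ) ≠ 0 := Nat.cast_ne_zero.mpr hd
  have hsum : (∑ i ∈ Finset.range d, (-1) ^ i * bernoulliSeries ((t + i) / d) d) *
      (expSeries d - 1) = PowerSeries.C (d : ℂ) * PowerSeries.X * expSeries t *
        ∑ i ∈ Finset.range d, (-expSeries 1) ^ i := by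
    rw [Finset.sum_mul, Finset.mul_sum]
    refine Finset.sum_congr rfl fun i _ => ?_
    have : (((t + i) / d : ℝ) : ℂ) * d = t + i * 1 := by
      push_cast; field_simp
    rw [mul_assoc, bernoulliSeries_mul, this, expSeries_add, ← expSeries_pow, neg_pow]
    ring
  have hgeom : (∑ i ∈ Finset.range d, (-expSeries 1) ^ i) * (-expSeries 1 - 1) =
      expSeries d - 1 := by
    rw [geom_sum_mul, hd2.neg_pow, expSeries_pow, mul_one]
  have hE : PowerSeries.mk (fun n => (eulerPoly n t : ℂ) / (n.factorial : ℂ)) *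
      (expSeries 1 + 1) = 2 * expSeries t := by
    have h := congrArg (PowerSeries.map (algebraMap ℝ ℂ)) (eulerPoly_generating t)
    simp only [map_mul, map_add, map_one, PowerSeries.map_exp, map_ofNat] at h
    have e1 : expSeries 1 = PowerSeries.exp ℂ := by simp [expSeries]
    have e2 : PowerSeries.map (algebraMap ℝ ℂ) (PowerSeries.rescale t (PowerSeries.exp ℝ)) =
        expSeries t := by
      ext n
      simp [expSeries, PowerSeries.coeff_rescale, PowerSeries.coeff_exp]
    rw [e1, ← e2, ← h]
    congr 1
    ext n
    simp
  have hne : expSeries 1 + 1 ≠ 0 := by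
    intro h
    have := congrArg (PowerSeries.coeff 1) h
    simp [expSeries, PowerSeries.coeff_exp, PowerSeries.coeff_one] at this
  have hmain : 2 * (∑ i ∈ Finset.range d, (-1) ^ i * bernoulliSeries ((t + i) / d) d) =
      -(PowerSeries.C (d : ℂ) * (PowerSeries.X *
        PowerSeries.mk (fun n => (eulerPoly n t : ℂ) / (n.factorial : ℂ)))) := by
    apply mul_right_cancel₀ (mul_ne_zero hne (expSeries_sub_one_ne_zero hdC))
    linear_combination 2 * (expSeries 1 + 1) * hsum - 2 * PowerSeries.C (d : ℂ) *
      PowerSeries.X * expSeries t * hgeom + PowerSeries.C (d : ℂ) * PowerSeries.X *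
        (expSeries d - 1) * hE
  have hc := congrArg (fun s => (M.factorial : ℂ) * PowerSeries.coeff M s) hmain
  have hsgn : ∀ i : ℕ, ((-1) ^ i : PowerSeries ℂ) = PowerSeries.C ((-1) ^ i) := by
    intro i; simp
  have h2 : (2 : PowerSeries ℂ) = PowerSeries.C 2 := (map_ofNat PowerSeries.C 2).symm
  have hf : (M.factorial : ℂ) ≠ 0 := Nat.cast_ne_zero.mpr M.factorial_ne_zero
  simp only [hsgn, h2, PowerSeries.coeff_C_mul, map_sum, map_neg, bernoulliSeries,
    PowerSeries.coeff_mk] at hc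
  have hl : (M.factorial : ℂ) * (2 * ∑ i ∈ Finset.range d, (-1) ^ i *
      ((bernoulliFun M ((t + i) / d) : ℂ) * (d : ℂ) ^ M / (M.factorial : ℂ))) =
      2 * ((d : ℂ) ^ M * ∑ i ∈ Finset.range d, (-1) ^ i * (bernoulliFun M ((t + i) / d) : ℂ)) := by
    simp only [Finset.mul_sum]
    refine Finset.sum_congr rfl fun i _ => ?_
    field_simp
  rw [hl] at hc
  have hr : (M.factorial : ℂ) * -((d : ℂ) * PowerSeries.coeff M (PowerSeries.X *
      PowerSeries.mk (fun n => (eulerPoly n t : ℂ) / (n.factorial : ℂ)))) =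
      -(d : ℂ) * M * eulerPoly (M - 1) t := by
    cases M with
    | zero => simp
    | succ M =>
      rw [PowerSeries.coeff_succ_X_mul, PowerSeries.coeff_mk, Nat.factorial_succ]
      have : (M.factorial : ℂ) ≠ 0 := Nat.cast_ne_zero.mpr M.factorial_ne_zero
      push_cast
      field_simp
  rw [hr] at hc
  have hc' : (2 : ℝ) * ((d : ℝ) ^ M * ∑ i ∈ Finset.range d, (-1) ^ i *
      bernoulliFun M ((t + i) / d)) = -(d : ℝ) * M * eulerPoly (M - 1) t := by
    exact_mod_cast hc
  linarith

theorem periodicB_add_one (n : ℕ) (x : ℝ) : periodicB n (x + 1) = periodicB n x := by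
  simp [periodicB]

theorem periodicB_periodic (n : ℕ) : Function.Periodic (periodicB n) 1 := periodicB_add_one n

theorem periodicE_add_one (n : ℕ) (x : ℝ) : periodicE n (x + 1) = -periodicE n x := by
  simp [periodicE, zpow_add₀]

theorem fract_div_of_lt {c : ℕ} {t : ℝ} (ht : t ∈ Set.Ico (0 : ℝ) 1) {i : ℕ}
    (hi : i ∈ Finset.range c) : Int.fract ((t + i) / c) = (t + i) / c := by
  have hi' : (i : ℝ) + 1 ≤ c := by exact_mod_cast Finset.mem_range.mp hi
  have hc : (0 : ℝ) < c := by linarith [Nat.cast_nonneg (α := ℝ) i]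
  rw [Int.fract_eq_self]
  refine ⟨div_nonneg (add_nonneg ht.1 (Nat.cast_nonneg i)) hc.le, ?_⟩
  rw [div_lt_one hc]
  linarith [ht.2]

/-- Distribution relation for the Bernoulli functions. -/
theorem periodicB_sum_div (M : ℕ) {c : ℕ} (hc : c ≠ 0) (t : ℝ) :
    (c : ℝ) ^ M * ∑ i ∈ Finset.range c, periodicB M ((t + i) / c) = c * periodicB M t := by
  have hc' : (c : ℝ) ≠ 0 := Nat.cast_ne_zero.mpr hc
  have hper : Function.Periodic
      (fun t : ℝ => ∑ i ∈ Finset.range c, periodicB M ((t + i) / c)) 1 := by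
    intro t
    have h1 := Finset.sum_range_succ (fun i : ℕ => periodicB M ((t + i) / c)) c
    have h2 := Finset.sum_range_succ' (fun i : ℕ => periodicB M ((t + i) / c)) c
    have h3 : periodicB M ((t + c) / c) = periodicB M ((t + (0 : ℕ)) / c) := by
      rw [← periodicB_add_one M ((t + (0 : ℕ)) / _)]
      congr 1
      field_simp
      simp
    have h4 : ∑ i ∈ Finset.range c, periodicB M ((t + 1 + i) / c) =
        ∑ i ∈ Finset.range c, periodicB M ((t + (i + 1 : ℕ)) / c) := by
      refine Finset.sum_congr rfl fun i _ => ?_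
      push_cast
      ring_nf
    simp only
    rw [h4]
    linarith
  have hred := hper.sub_int_mul_eq ⌊t⌋ (x := t)
  have hred' := (periodicB_periodic M).sub_int_mul_eq ⌊t⌋ (x := t)
  simp only [mul_one, Int.self_sub_floor] at hred hred'
  rw [← hred, ← hred']
  have ht : Int.fract t ∈ Set.Ico (0 : ℝ) 1 := ⟨Int.fract_nonneg t, Int.fract_lt_one t⟩
  generalize Int.fract t = s at ht
  have hs : Int.fract s = s := Int.fract_eq_self.mpr ht
  -- Only here does the convention 𝔅_1(0) = 0 matter. It alters the i = 0 term and the right-hand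
  -- side by matching amounts.
  by_cases hcase : M = 1 ∧ s = 0
  · obtain ⟨rfl, rfl⟩ := hcase
    have h := bernoulliFun_sum_div 1 hc 0
    obtain ⟨c, rfl⟩ := Nat.exists_eq_succ_of_ne_zero hc
    rw [Finset.sum_range_succ'] at h ⊢
    have e : ∑ i ∈ Finset.range c, periodicB 1 ((0 + (i + 1 : ℕ)) / (c.succ : ℕ)) =
        ∑ i ∈ Finset.range c, bernoulliFun 1 ((0 + (i + 1 : ℕ)) / (c.succ : ℕ)) := by
      refine Finset.sum_congr rfl fun i hi => ?_
      have hi' : i + 1 ∈ Finset.range c.succ := by simpa using hi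
      rw [periodicB_of_fract_ne_zero, fract_div_of_lt ht hi']
      rw [fract_div_of_lt ht hi']
      positivity
    rw [e]
    have e0 : periodicB 1 0 = 0 := by simp [periodicB]
    simp only [Nat.cast_zero, add_zero, zero_div, e0] at h ⊢
    rw [pow_one] at h ⊢
    linarith
  · have e : ∀ i ∈ Finset.range c, periodicB M ((s + i) / c) = bernoulliFun M ((s + i) / c) := by
      intro i hi
      rw [periodicB, fract_div_of_lt ht hi, if_neg]
      rintro ⟨hM, h0⟩
      apply hcase
      refine ⟨hM, ?_⟩
      rw [div_eq_zero_iff, or_iff_left hc'] at h0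
      linarith [ht.1, Nat.cast_nonneg (α := ℝ) i]
    rw [Finset.sum_congr rfl e, bernoulliFun_sum_div M hc, periodicB, hs, if_neg hcase]

/-- Alternating distribution relation, expressing Euler functions by Bernoulli functions. -/
theorem alternating_periodicB_sum_div (M : ℕ) {d : ℕ} (hd : d ≠ 0) (hd2 : Even d) {t : ℝ}
    (ht0 : Int.fract t ≠ 0) :
    (d : ℝ) ^ M * ∑ i ∈ Finset.range d, (-1) ^ i * periodicB M ((t + i) / d) =
      -(d / 2) * M * periodicE (M - 1) t := by
  have hd' : (d : ℝ) ≠ 0 := Nat.cast_ne_zero.mpr hd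
  -- Shifting t by 1 reindexes i and flips the sign; the wrap-around term fits because (-1)^d = 1.
  -- Both sides are antiperiodic, so t may be replaced by its fractional part.
  have hper : Function.Antiperiodic
      (fun t : ℝ => ∑ i ∈ Finset.range d, (-1) ^ i * periodicB M ((t + i) / d)) 1 := by
    intro t
    have h1 := Finset.sum_range_succ (fun i : ℕ => (-1) ^ i * periodicB M ((t + i) / d)) d
    have h2 := Finset.sum_range_succ' (fun i : ℕ => (-1) ^ i * periodicB M ((t + i) / d)) d
    have h3 : periodicB M ((t + d) / d) = periodicB M ((t + (0 : ℕ)) / d) := by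
      rw [← periodicB_add_one M ((t + (0 : ℕ)) / _)]
      congr 1
      field_simp
      simp
    have h4 : ∑ i ∈ Finset.range d, (-1) ^ i * periodicB M ((t + 1 + i) / d) =
        -∑ i ∈ Finset.range d, (-1) ^ (i + 1) * periodicB M ((t + (i + 1 : ℕ)) / d) := by
      rw [← Finset.sum_neg_distrib]
      refine Finset.sum_congr rfl fun i _ => ?_
      push_cast
      ring_nf
    simp only
    rw [h4]
    rw [h3, hd2.neg_one_pow] at h1
    rw [pow_zero] at h2
    linarith
  have hE : Function.Antiperiodic (periodicE (M - 1)) 1 := periodicE_add_one _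
  have hred := hper.sub_int_mul_eq ⌊t⌋ (x := t)
  have hred' := hE.sub_int_mul_eq ⌊t⌋ (x := t)
  simp only [mul_one, Int.self_sub_floor] at hred hred'
  have ht : Int.fract t ∈ Set.Ico (0 : ℝ) 1 := ⟨Int.fract_nonneg t, Int.fract_lt_one t⟩
  have hmain : (d : ℝ) ^ M * ∑ i ∈ Finset.range d, (-1) ^ i * periodicB M ((Int.fract t + i) / d) =
      -(d / 2) * M * periodicE (M - 1) (Int.fract t) := by
    have e : ∀ i ∈ Finset.range d, (-1) ^ i * periodicB M ((Int.fract t + i) / d) =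
        (-1) ^ i * bernoulliFun M ((Int.fract t + i) / d) := by
      intro i hi
      rw [periodicB_of_fract_ne_zero, fract_div_of_lt ht hi]
      rw [fract_div_of_lt ht hi]
      have : 0 < Int.fract t := lt_of_le_of_ne ht.1 (Ne.symm ht0)
      positivity
    rw [Finset.sum_congr rfl e, alternating_bernoulliFun_sum_div M hd hd2, periodicE]
    simp
  rw [hred, hred'] at hmain
  have hu : ((⌊t⌋.negOnePow : ℤ) : ℝ) ≠ 0 := by simp
  apply mul_left_cancel₀ hu
  linear_combination hmain

/-! ### Sums of periodic functions and of characters -/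

theorem sum_range_add_of_periodic {f : ℕ → ℂ} {N : ℕ} (hf : Function.Periodic f N) (a : ℕ) :
    ∑ n ∈ Finset.range N, f (n + a) = ∑ n ∈ Finset.range N, f n := by
  induction a with
  | zero => simp
  | succ a ih =>
    rw [← ih]
    have h1 := Finset.sum_range_succ (fun n => f (n + a)) N
    have h2 := Finset.sum_range_succ' (fun n => f (n + a)) N
    have h3 : f (N + a) = f (0 + a) := by rw [zero_add, add_comm]; exact hf a
    have h4 : ∑ n ∈ Finset.range N, f (n + (a + 1)) = ∑ n ∈ Finset.range N, f (n + 1 + a) :=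
      Finset.sum_congr rfl fun n _ => by congr 1; ring
    rw [h4]
    rw [h1, h3] at h2
    exact (add_right_cancel h2).symm

theorem sum_Icc_of_periodic {f : ℕ → ℂ} {N : ℕ} (hf : Function.Periodic f N) :
    ∑ n ∈ Finset.Icc 1 N, f n = ∑ n ∈ Finset.range N, f n := by
  rw [← sum_range_add_of_periodic hf 1, Finset.range_eq_Ico, Finset.sum_Ico_add' f 0 N 1]
  rfl

theorem sum_range_mul_eq (f : ℕ → ℂ) (c k : ℕ) :
    ∑ n ∈ Finset.range (c * k), f n =
      ∑ j ∈ Finset.range k, ∑ i ∈ Finset.range c, f (j + k * i) := by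
  rw [Finset.sum_comm]
  induction c with
  | zero => simp
  | succ c ih =>
    rw [Nat.succ_mul, Finset.sum_range_add, ih, Finset.sum_range_succ]
    congr 1
    exact Finset.sum_congr rfl fun j _ => by congr 1; ring

theorem sum_range_natCast_zmod {k : ℕ} [NeZero k] (f : ZMod k → ℂ) :
    ∑ i ∈ Finset.range k, f (i : ZMod k) = ∑ a, f a := by
  refine Finset.sum_nbij' (fun i => (i : ZMod k)) ZMod.val ?_ ?_ ?_ ?_ ?_
  · simp
  · intro a _; exact Finset.mem_range.mpr (ZMod.val_lt a)
  · intro i hi; exact ZMod.val_natCast_of_lt (Finset.mem_range.mp hi)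
  · intro a _; exact ZMod.natCast_zmod_val a
  · simp

/-- As d is a unit mod k, the progression meets each residue class once, so orthogonality applies.
-/
theorem sum_character_arith_progression {k : ℕ} [NeZero k] {χ : DirichletCharacter ℂ k}
    (hne : χ ≠ 1) {d : ℕ} (hd : Nat.Coprime d k) (n : ℕ) :
    ∑ i ∈ Finset.range k, χ ((n + i * d : ℕ) : ZMod k) = 0 := by
  have h := sum_range_natCast_zmod (fun a : ZMod k => χ (n + a * d))
  have e : ∑ a : ZMod k, χ (n + a * d) = ∑ a, χ a := by
    refine Fintype.sum_equiv (((ZMod.unitOfCoprime d hd).mulRight).trans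
      (Equiv.addLeft (n : ZMod k))) _ _ fun a => ?_
    simp
  rw [e, MulChar.sum_eq_zero_of_ne_one hne] at h
  rw [← h]
  exact Finset.sum_congr rfl fun i _ => by push_cast; rfl

theorem periodicB_div_add_periodic (M : ℕ) {N : ℕ} (hN : N ≠ 0) (s : ℝ) :
    Function.Periodic (fun n : ℕ => periodicB M ((n : ℝ) / N + s)) N := by
  intro n
  have hN' : (N : ℝ) ≠ 0 := Nat.cast_ne_zero.mpr hN
  simp only
  rw [← periodicB_add_one M (n / N + s)]
  congr 1
  push_cast
  field_simp
  ring

theorem periodicB_neg_div_add_periodic (M : ℕ) {N : ℕ} (hN : N ≠ 0) (s : ℝ) :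
    Function.Periodic (fun n : ℕ => periodicB M (s - (n : ℝ) / N)) N := by
  intro n
  have hN' : (N : ℝ) ≠ 0 := Nat.cast_ne_zero.mpr hN
  simp only
  rw [← periodicB_add_one M (s - (n + N : ℕ) / N)]
  congr 1
  push_cast
  field_simp
  ring

/-! ### Vanishing of the double character sum -/

/-- The diagonal shift by (a, b) preserves F and v and moves only u. Averaging the double sum over k
such shifts puts the vanishing sums of u inside. -/
theorem double_sum_eq_zero_of_shift {A B k a b : ℕ} (hk : k ≠ 0) {u v : ℕ → ℂ}
    {F : ℕ → ℕ → ℂ} (hu : Function.Periodic u A) (hv : Function.Periodic v B)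
    (hF₁ : ∀ l, Function.Periodic (fun n => F n l) A)
    (hF₂ : ∀ n, Function.Periodic (fun l => F n l) B)
    (hF : ∀ n l, F (n + a) (l + b) = F n l)
    (hvb : ∀ l, v (l + b) = v l)
    (hsum : ∀ n, ∑ i ∈ Finset.range k, u (n + i * a) = 0) :
    ∑ n ∈ Finset.range A, ∑ l ∈ Finset.range B, u n * v l * F n l = 0 := by
  have hFi : ∀ i n l, F (n + i * a) (l + i * b) = F n l := by
    intro i
    induction i with
    | zero => simp
    | succ i ih =>
      intro n l
      rw [← ih n l, ← hF (n + i * a) (l + i * b)]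
      congr 1 <;> ring
  have hvi : ∀ i l, v (l + i * b) = v l := by
    intro i
    induction i with
    | zero => simp
    | succ i ih =>
      intro l
      rw [← ih l, ← hvb (l + i * b)]
      congr 1; ring
  have hstep : ∀ i, ∑ n ∈ Finset.range A, ∑ l ∈ Finset.range B, u n * v l * F n l =
      ∑ n ∈ Finset.range A, ∑ l ∈ Finset.range B, u (n + i * a) * v l * F n l := by
    intro i
    have h1 := sum_range_add_of_periodic (N := A)
      (f := fun n => ∑ l ∈ Finset.range B, u n * v l * F n l) (fun n => by
        refine Finset.sum_congr rfl fun l _ => ?_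
        rw [hu n]
        exact congrArg _ (hF₁ l n)) (i * a)
    rw [← h1]
    refine Finset.sum_congr rfl fun n _ => ?_
    have h2 := sum_range_add_of_periodic (N := B)
      (f := fun l => u (n + i * a) * v l * F (n + i * a) l) (fun l => by
        simp only
        rw [hv l]
        exact congrArg _ (hF₂ (n + i * a) l)) (i * b)
    rw [← h2]
    refine Finset.sum_congr rfl fun l _ => ?_
    rw [hFi, hvi]
  have hkS : (k : ℂ) * ∑ n ∈ Finset.range A, ∑ l ∈ Finset.range B, u n * v l * F n l = 0 := by
    calc _ = ∑ i ∈ Finset.range k, ∑ n ∈ Finset.range A, ∑ l ∈ Finset.range B,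
          u (n + i * a) * v l * F n l := by
          rw [← Finset.sum_congr rfl fun i _ => hstep i]; simp
      _ = ∑ n ∈ Finset.range A, ∑ l ∈ Finset.range B,
          (∑ i ∈ Finset.range k, u (n + i * a)) * (v l * F n l) := by
          rw [Finset.sum_comm]
          refine Finset.sum_congr rfl fun n _ => ?_
          rw [Finset.sum_comm]
          refine Finset.sum_congr rfl fun l _ => ?_
          rw [Finset.sum_mul]
          exact Finset.sum_congr rfl fun i _ => by ring
      _ = 0 := by simp [hsum]
  exact (mul_eq_zero.mp hkS).resolve_left (Nat.cast_ne_zero.mpr hk)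

theorem character_natCast_periodic {k : ℕ} (χ : DirichletCharacter ℂ k) {N : ℕ} (hN : k ∣ N) :
    Function.Periodic (fun n : ℕ => χ (n : ZMod k)) N := by
  intro n
  simp only [Nat.cast_add, (ZMod.natCast_eq_zero_iff N k).mpr hN, add_zero]

theorem alternating_character_periodic {k : ℕ} (χ : DirichletCharacter ℂ k) {N : ℕ} (hN : k ∣ N)
    (hN2 : Even N) : Function.Periodic (fun n : ℕ => (-1 : ℂ) ^ n * χ (n : ZMod k)) N := by
  intro n
  simp only [Nat.cast_add, (ZMod.natCast_eq_zero_iff N k).mpr hN, add_zero, pow_add,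
    hN2.neg_one_pow, mul_one]

theorem star_ne_one {k : ℕ} {χ : DirichletCharacter ℂ k} (hne : χ ≠ 1) : star χ ≠ 1 := by
  rw [MulChar.star_eq_inv]
  simpa using hne

/-- The double character sums of Bernoulli functions vanish if `k` divides `d` or `c`. -/
theorem double_character_sum_eq_zero {k : ℕ} [NeZero k] {χ : DirichletCharacter ℂ k}
    (hne : χ ≠ 1) {c d : ℕ} (hc : c ≠ 0) (hd : d ≠ 0) (hcop : Nat.Coprime c d)
    (hdeven : Even d) (hcd : k ∣ d ∨ k ∣ c) (N : ℕ) :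
    ∑ n ∈ Finset.range (d * k), ∑ l ∈ Finset.range (c * k),
      ((-1) ^ n * χ (n : ZMod k)) * (star χ) (l : ZMod k) *
        (periodicB N ((l : ℝ) / (c * k : ℕ) - (n : ℝ) / (d * k : ℕ)) : ℂ) = 0 := by
  have hk : k ≠ 0 := NeZero.ne k
  have hkR : (k : ℝ) ≠ 0 := Nat.cast_ne_zero.mpr hk
  have hcR : (c : ℝ) ≠ 0 := Nat.cast_ne_zero.mpr hc
  have hdR : (d : ℝ) ≠ 0 := Nat.cast_ne_zero.mpr hd
  have hw := alternating_character_periodic χ (dvd_mul_left k d) (hdeven.mul_right k)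
  have hv := character_natCast_periodic (star χ) (dvd_mul_left k c)
  have hF₁ : ∀ l : ℕ, Function.Periodic (fun n : ℕ =>
      (periodicB N ((l : ℝ) / (c * k : ℕ) - (n : ℝ) / (d * k : ℕ)) : ℂ)) (d * k) := fun l n =>
    congrArg _ (periodicB_neg_div_add_periodic N (mul_ne_zero hd hk) _ n)
  have hF₂ : ∀ n : ℕ, Function.Periodic (fun l : ℕ =>
      (periodicB N ((l : ℝ) / (c * k : ℕ) - (n : ℝ) / (d * k : ℕ)) : ℂ)) (c * k) := fun n l =>
    congrArg _ (periodicB_div_add_periodic N (mul_ne_zero hc hk) _ l)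
  have hF : ∀ n l : ℕ, (periodicB N (((l + c : ℕ) : ℝ) / (c * k : ℕ) -
      ((n + d : ℕ) : ℝ) / (d * k : ℕ)) : ℂ) =
      (periodicB N ((l : ℝ) / (c * k : ℕ) - (n : ℝ) / (d * k : ℕ)) : ℂ) := by
    intro n l
    congr 2
    push_cast
    field_simp
    ring
  -- The shift (n, l) ↦ (n + d, l + c) fixes y - x. If k ∣ d, it fixes the weight in n and the sum
  -- of χ̄(l + ic) vanishes; if k ∣ c, it fixes χ̄(l) and the sum of χ(n + id) vanishes, the sign
  -- being unaffected as d is even.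
  rcases hcd with h | h
  · rw [Finset.sum_comm]
    have := double_sum_eq_zero_of_shift (a := c) (b := d) hk hv hw
      (F := fun l n => (periodicB N ((l : ℝ) / (c * k : ℕ) - (n : ℝ) / (d * k : ℕ)) : ℂ))
      hF₂ hF₁ (fun l n => hF n l) (alternating_character_periodic χ h hdeven)
      (sum_character_arith_progression (star_ne_one hne) (hcop.coprime_dvd_right h))
    rw [← this]
    exact Finset.sum_congr rfl fun l _ => Finset.sum_congr rfl fun n _ => by ring
  · refine double_sum_eq_zero_of_shift (a := d) (b := c) hk hw hv hF₁ hF₂ hF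
      (character_natCast_periodic (star χ) h) fun n => ?_
    have := sum_character_arith_progression hne (hcop.symm.coprime_dvd_right h) n
    rw [← mul_zero ((-1 : ℂ) ^ n), ← this, Finset.mul_sum]
    exact Finset.sum_congr rfl fun i _ => by
      rw [pow_add, (hdeven.mul_left i).neg_one_pow, mul_one]

/-! ### Character-twisted distribution relations -/

/-- Twisted distribution relation for the generalized Bernoulli functions. -/
theorem charB_eq_sum {k : ℕ} [NeZero k] (χ : DirichletCharacter ℂ k) {c : ℕ} (hc : c ≠ 0)
    (M : ℕ) (s : ℝ) :
    ((c : ℂ) * k) ^ M * ∑ l ∈ Finset.range (c * k),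
        (star χ) (l : ZMod k) * (periodicB M ((l : ℝ) / (c * k : ℕ) - s) : ℂ) =
      c * k * charB M χ (-(c * k * s)) := by
  have hk : k ≠ 0 := NeZero.ne k
  have hkR : (k : ℝ) ≠ 0 := Nat.cast_ne_zero.mpr hk
  have hkC : (k : ℂ) ≠ 0 := Nat.cast_ne_zero.mpr hk
  have hcR : (c : ℝ) ≠ 0 := Nat.cast_ne_zero.mpr hc
  rw [sum_range_mul_eq, charB, zpow_sub₀ hkC, zpow_natCast, zpow_one, Finset.mul_sum,
    Finset.mul_sum, Finset.mul_sum]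
  refine Finset.sum_congr rfl fun j _ => ?_
  have h := congrArg ((↑) : ℝ → ℂ) (periodicB_sum_div M hc ((j + -(c * k * s)) / k))
  push_cast at h
  have e : ∀ i : ℕ, ((j + k * i : ℕ) : ℝ) / (c * k : ℕ) - s =
      ((j + -(c * k * s)) / k + i) / c := by
    intro i; push_cast; field_simp; ring
  simp only [e]
  simp only [Nat.cast_add, Nat.cast_mul, ZMod.natCast_self, zero_mul, add_zero]
  have e2 : ∀ w : ℂ, (c : ℂ) * k * ((k : ℂ) ^ M / k * w) = (k : ℂ) ^ M * (c * w) := by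
    intro w; field_simp
  rw [← Finset.mul_sum, mul_pow, e2]
  linear_combination (star χ) (j : ZMod k) * (k : ℂ) ^ M * h

/-- Alternating twisted distribution relation for the character Euler functions. -/
theorem charE_eq_sum {k : ℕ} [NeZero k] (hk2 : Odd k) (χ : DirichletCharacter ℂ k) {d : ℕ}
    (hd : d ≠ 0) (hd2 : Even d) (M : ℕ) (s : ℝ)
    (hs : ∀ j : ℕ, χ (j : ZMod k) ≠ 0 → Int.fract (((j : ℝ) + d * k * s) / k) ≠ 0) :
    ((d : ℂ) * k) ^ M * ∑ n ∈ Finset.range (d * k),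
        (-1) ^ n * χ (n : ZMod k) * (periodicB M ((n : ℝ) / (d * k : ℕ) + s) : ℂ) =
      -(d * k * (M / 2)) * charE (M - 1) (star χ) (d * k * s) := by
  have hk : k ≠ 0 := NeZero.ne k
  have hkR : (k : ℝ) ≠ 0 := Nat.cast_ne_zero.mpr hk
  have hdR : (d : ℝ) ≠ 0 := Nat.cast_ne_zero.mpr hd
  rw [sum_range_mul_eq, charE, star_star, Finset.mul_sum, Finset.mul_sum, Finset.mul_sum]
  refine Finset.sum_congr rfl fun j _ => ?_
  by_cases hj : χ (j : ZMod k) = 0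
  · simp [hj]
  have h := congrArg ((↑) : ℝ → ℂ) (alternating_periodicB_sum_div M hd hd2 (hs j hj))
  push_cast at h
  have e : ∀ i : ℕ, ((j + k * i : ℕ) : ℝ) / (d * k : ℕ) + s =
      ((j + d * k * s) / k + i) / d := by
    intro i; push_cast; field_simp; ring
  -- Oddness of k makes the sign split along n = j + ki.
  have e2 : ∀ i : ℕ, (-1 : ℂ) ^ (j + k * i) = (-1) ^ j * (-1) ^ i := by
    intro i; rw [pow_add, pow_mul, hk2.neg_one_pow]
  simp only [e, e2]
  simp only [Nat.cast_add, Nat.cast_mul, ZMod.natCast_self, zero_mul, add_zero]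
  have e3 : ∑ i ∈ Finset.range d, (-1 : ℂ) ^ j * (-1) ^ i * χ (j : ZMod k) *
      (periodicB M (((j + d * k * s) / k + i) / d) : ℂ) = (-1) ^ j * χ (j : ZMod k) *
      ∑ i ∈ Finset.range d, (-1 : ℂ) ^ i * (periodicB M (((j + d * k * s) / k + i) / d) : ℂ) := by
    rw [Finset.mul_sum]
    exact Finset.sum_congr rfl fun i _ => by ring
  rw [e3, mul_pow]
  -- For M = 0 the truncated index M - 1 is harmless because of the factor M.
  rcases M with _ | M
  · have h0 : ∑ i ∈ Finset.range d, (-1 : ℂ) ^ i *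
        (periodicB 0 (((j + d * k * s) / k + i) / d) : ℂ) = 0 := by simpa using h
    rw [h0]; simp
  · rw [Nat.add_sub_cancel] at h ⊢
    push_cast at h ⊢
    rw [pow_succ (k : ℂ)]
    linear_combination (-1) ^ j * χ (j : ZMod k) * (k : ℂ) ^ M * k * h

/-- The substitution n ↦ dk - n preserves parity, dk being even, and costs a factor χ(-1). -/
theorem sum_range_alternating_neg {k : ℕ} [NeZero k] (χ : DirichletCharacter ℂ k) {d : ℕ}
    (hd : d ≠ 0) (hd2 : Even d) (M : ℕ) (y : ℝ) :
    ∑ n ∈ Finset.range (d * k),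
        (-1) ^ n * χ (n : ZMod k) * (periodicB M (y - (n : ℝ) / (d * k : ℕ)) : ℂ) =
      χ (-1) * ∑ n ∈ Finset.range (d * k),
        (-1) ^ n * χ (n : ZMod k) * (periodicB M ((n : ℝ) / (d * k : ℕ) + y) : ℂ) := by
  have hk : k ≠ 0 := NeZero.ne k
  have hN : d * k ≠ 0 := mul_ne_zero hd hk
  have hNR : ((d * k : ℕ) : ℝ) ≠ 0 := Nat.cast_ne_zero.mpr hN
  have hper : Function.Periodic (fun n : ℕ => (-1) ^ n * χ (n : ZMod k) *
      (periodicB M ((n : ℝ) / (d * k : ℕ) + y) : ℂ)) (d * k) := by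
    intro n
    have h1 := alternating_character_periodic χ (dvd_mul_left k d) (hd2.mul_right k) n
    have h2 := periodicB_div_add_periodic M hN y n
    simp only at h1 h2 ⊢
    rw [h1, h2]
  rw [← sum_range_add_of_periodic hper 1, Finset.mul_sum, ← Finset.sum_range_reflect]
  refine Finset.sum_congr rfl fun n hn => ?_
  have hn' : n + 1 ≤ d * k := Finset.mem_range.mp hn
  have e : d * k - 1 - n = d * k - (n + 1) := by omega
  rw [e]
  have e1 : ((d * k - (n + 1) : ℕ) : ZMod k) = -1 * ((n + 1 : ℕ) : ZMod k) := by
    rw [Nat.cast_sub hn']; simp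
  have e2 : (-1 : ℂ) ^ (d * k - (n + 1)) = (-1) ^ (n + 1) := by
    apply neg_one_pow_congr
    have := (hd2.mul_right k)
    rw [Nat.even_sub hn']
    tauto
  have e3 : periodicB M (y - ((d * k - (n + 1) : ℕ) : ℝ) / (d * k : ℕ)) =
      periodicB M (((n + 1 : ℕ) : ℝ) / (d * k : ℕ) + y) := by
    rw [← periodicB_add_one, Nat.cast_sub hn']
    congr 1
    field_simp
    ring
  rw [e1, e2, e3, map_mul]
  ring

/-! ### Non-integrality of the arguments -/

theorem coprime_of_character_ne_zero {k : ℕ} {χ : DirichletCharacter ℂ k} {n : ℕ}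
    (hn : χ (n : ZMod k) ≠ 0) : Nat.Coprime n k := by
  by_contra h
  exact hn (χ.map_nonunit fun hu => h ((ZMod.isUnit_iff_coprime n k).mp hu))

theorem not_dvd_of_character_ne_zero {k : ℕ} {χ : DirichletCharacter ℂ k} (hk : k ≠ 1) {n : ℕ}
    (hn : χ (n : ZMod k) ≠ 0) : ¬k ∣ n := fun h =>
  hk (Nat.Coprime.eq_one_of_dvd (coprime_of_character_ne_zero hn).symm h)

theorem modulus_ne_one {k : ℕ} {χ : DirichletCharacter ℂ k} (hne : χ ≠ 1) : k ≠ 1 := by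
  rintro rfl
  exact hne (DirichletCharacter.level_one χ)

theorem character_ne_zero_of_star_ne_zero {k : ℕ} {χ : DirichletCharacter ℂ k} {a : ZMod k}
    (ha : (star χ) a ≠ 0) : χ a ≠ 0 := by
  intro h
  apply ha
  rw [MulChar.star_apply, h, star_zero]

theorem fract_div_ne_zero {k : ℕ} [NeZero k] {χ : DirichletCharacter ℂ k} (hne : χ ≠ 1) {n c : ℕ}
    (hc : c ≠ 0) (hn : χ (n : ZMod k) ≠ 0) : Int.fract ((n : ℝ) / (c * k : ℕ)) ≠ 0 := by
  intro h
  obtain ⟨q, hq⟩ := Int.fract_eq_zero_iff.mp h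
  have hN : ((c * k : ℕ) : ℝ) ≠ 0 := Nat.cast_ne_zero.mpr (mul_ne_zero hc (NeZero.ne k))
  rw [eq_div_iff hN] at hq
  have hq' : q * (c * k : ℕ) = (n : ℤ) := by exact_mod_cast hq
  apply not_dvd_of_character_ne_zero (modulus_ne_one hne) hn
  have : (k : ℤ) ∣ n := ⟨q * c, by rw [← hq']; push_cast; ring⟩
  exact_mod_cast this

/-- Integrality would give d ∣ cn and c ∣ dl, hence d ∣ n and c ∣ l. Whichever of d, c is divisible
by k then contradicts the nonvanishing of χ at n or at l. -/
theorem fract_sub_div_ne_zero {k : ℕ} [NeZero k] {χ : DirichletCharacter ℂ k} (hne : χ ≠ 1)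
    {c d n l : ℕ} (hc : c ≠ 0) (hd : d ≠ 0) (hcop : Nat.Coprime c d) (hcd : k ∣ d ∨ k ∣ c)
    (hn : χ (n : ZMod k) ≠ 0) (hl : χ (l : ZMod k) ≠ 0) :
    Int.fract ((l : ℝ) / (c * k : ℕ) - (n : ℝ) / (d * k : ℕ)) ≠ 0 := by
  intro h
  obtain ⟨q, hq⟩ := Int.fract_eq_zero_iff.mp h
  have hkR : (k : ℝ) ≠ 0 := Nat.cast_ne_zero.mpr (NeZero.ne k)
  have hcR : (c : ℝ) ≠ 0 := Nat.cast_ne_zero.mpr hc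
  have hdR : (d : ℝ) ≠ 0 := Nat.cast_ne_zero.mpr hd
  have hq2 : (q : ℝ) * c * d * k = d * l - c * n := by
    rw [hq]; push_cast; field_simp
  have hq' : q * c * d * k = (d * l - c * n : ℤ) := by exact_mod_cast hq2
  rcases hcd with h | h
  · have h1 : (d : ℤ) ∣ c * n := ⟨l - q * c * k, by linear_combination hq'⟩
    have h2 : d ∣ c * n := by exact_mod_cast h1
    exact not_dvd_of_character_ne_zero (modulus_ne_one hne) hn
      (h.trans (hcop.symm.dvd_of_dvd_mul_left h2))
  · have h1 : (c : ℤ) ∣ d * l := ⟨n + q * d * k, by linear_combination -hq'⟩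
    have h2 : c ∣ d * l := by exact_mod_cast h1
    exact not_dvd_of_character_ne_zero (modulus_ne_one hne) hl
      (h.trans (hcop.dvd_of_dvd_mul_left h2))

/-- Supplies the hypothesis of `charE_eq_sum` at s = l/(ck). Integrality forces c ∣ l; then k ∣ c
gives k ∣ l, while k ∣ d gives k ∣ j. -/
theorem fract_add_div_ne_zero {k : ℕ} [NeZero k] {χ : DirichletCharacter ℂ k} (hne : χ ≠ 1)
    {c d j l : ℕ} (hc : c ≠ 0) (hcop : Nat.Coprime c d) (hcd : k ∣ d ∨ k ∣ c)
    (hj : χ (j : ZMod k) ≠ 0) (hl : χ (l : ZMod k) ≠ 0) :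
    Int.fract (((j : ℝ) + d * k * ((l : ℝ) / (c * k : ℕ))) / k) ≠ 0 := by
  intro h
  obtain ⟨q, hq⟩ := Int.fract_eq_zero_iff.mp h
  have hkR : (k : ℝ) ≠ 0 := Nat.cast_ne_zero.mpr (NeZero.ne k)
  have hcR : (c : ℝ) ≠ 0 := Nat.cast_ne_zero.mpr hc
  have hq2 : (q : ℝ) * c * k = c * j + d * l := by
    rw [hq]; push_cast; field_simp
  have hq' : q * c * k = (c * j + d * l : ℤ) := by exact_mod_cast hq2
  have h1 : (c : ℤ) ∣ d * l := ⟨q * k - j, by linear_combination -hq'⟩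
  have h2 : c ∣ d * l := by exact_mod_cast h1
  obtain ⟨l', rfl⟩ := hcop.dvd_of_dvd_mul_left h2
  rcases hcd with h | h
  · obtain ⟨d', rfl⟩ := h
    have hcZ : (c : ℤ) ≠ 0 := by exact_mod_cast hc
    have h3 : (j : ℤ) = k * (q - d' * l') := by
      apply mul_left_cancel₀ hcZ
      push_cast at hq'
      linear_combination -hq'
    have h4 : (k : ℤ) ∣ j := ⟨_, h3⟩
    exact not_dvd_of_character_ne_zero (modulus_ne_one hne) hj (by exact_mod_cast h4)
  · exact not_dvd_of_character_ne_zero (modulus_ne_one hne) hl (h.mul_right l')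

/-! ### Evaluation of the three double sums -/

/-- Summing over l first leaves the inner sum of g₂(d, -c, z, p, χ). -/
theorem sum_periodicB_sub_mul_eq {k : ℕ} [NeZero k] (χ : DirichletCharacter ℂ k)
    {c d : ℕ} (hc : c ≠ 0) (hd : d ≠ 0) (hdeven : Even d) (m M : ℕ) :
    ((c : ℂ) * k) ^ M * ∑ n ∈ Finset.range (d * k), ∑ l ∈ Finset.range (c * k),
        ((-1) ^ n * χ (n : ZMod k)) * (star χ) (l : ZMod k) *
          ((periodicB m ((n : ℝ) / (d * k : ℕ)) : ℂ) *
            (periodicB M ((l : ℝ) / (c * k : ℕ) - (n : ℝ) / (d * k : ℕ)) : ℂ)) =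
      c * k * ∑ n ∈ Finset.Icc 1 (d * k),
        (-1) ^ n * χ (n : ZMod k) * charB M χ (((-(c : ℤ) : ℤ) : ℝ) * n / d) *
          (periodicB m ((n : ℝ) / ((d : ℝ) * k)) : ℂ) := by
  have hk : k ≠ 0 := NeZero.ne k
  have hkR : (k : ℝ) ≠ 0 := Nat.cast_ne_zero.mpr hk
  have hcR : (c : ℝ) ≠ 0 := Nat.cast_ne_zero.mpr hc
  have hdR : (d : ℝ) ≠ 0 := Nat.cast_ne_zero.mpr hd
  have hper : Function.Periodic (fun n : ℕ => ∑ l ∈ Finset.range (c * k),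
        ((-1) ^ n * χ (n : ZMod k)) * (star χ) (l : ZMod k) *
          ((periodicB m ((n : ℝ) / (d * k : ℕ)) : ℂ) *
            (periodicB M ((l : ℝ) / (c * k : ℕ) - (n : ℝ) / (d * k : ℕ)) : ℂ))) (d * k) := by
    intro n
    refine Finset.sum_congr rfl fun l _ => ?_
    have h1 := alternating_character_periodic χ (dvd_mul_left k d) (hdeven.mul_right k) n
    have h2 := periodicB_div_add_periodic m (mul_ne_zero hd hk) 0 n
    have h3 := periodicB_neg_div_add_periodic M (mul_ne_zero hd hk) ((l : ℝ) / (c * k : ℕ)) n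
    simp only [add_zero] at h1 h2 h3
    rw [h1, h2, h3]
  rw [← sum_Icc_of_periodic hper, Finset.mul_sum, Finset.mul_sum]
  refine Finset.sum_congr rfl fun n _ => ?_
  have h := charB_eq_sum χ hc M ((n : ℝ) / (d * k : ℕ))
  have e1 : -((c : ℝ) * k * ((n : ℝ) / (d * k : ℕ))) = ((-(c : ℤ) : ℤ) : ℝ) * n / d := by
    push_cast; field_simp
  have e2 : ((d : ℝ) * k) = (d * k : ℕ) := by push_cast; rfl
  rw [e1] at h
  rw [e2]
  calc _ = (-1) ^ n * χ (n : ZMod k) * (periodicB m ((n : ℝ) / (d * k : ℕ)) : ℂ) *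
      (((c : ℂ) * k) ^ M * ∑ l ∈ Finset.range (c * k), (star χ) (l : ZMod k) *
        (periodicB M ((l : ℝ) / (c * k : ℕ) - (n : ℝ) / (d * k : ℕ)) : ℂ)) := by
        simp only [Finset.mul_sum]
        exact Finset.sum_congr rfl fun l _ => by ring
    _ = _ := by rw [h]; ring

/-- Summing over n first, after reflecting n, leaves the inner sum of g₁ for χ̄; the reflection is
the source of χ(-1). -/
theorem sum_periodicB_mul_sub_eq {k : ℕ} [NeZero k] (hk2 : Odd k) {χ : DirichletCharacter ℂ k}
    (hne : χ ≠ 1) {c d : ℕ} (hc : c ≠ 0) (hd : d ≠ 0) (hcop : Nat.Coprime c d)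
    (hdeven : Even d) (hcd : k ∣ d ∨ k ∣ c) (m M : ℕ) :
    ((d : ℂ) * k) ^ M * ∑ n ∈ Finset.range (d * k), ∑ l ∈ Finset.range (c * k),
        ((-1) ^ n * χ (n : ZMod k)) * (star χ) (l : ZMod k) *
          ((periodicB m ((l : ℝ) / (c * k : ℕ)) : ℂ) *
            (periodicB M ((l : ℝ) / (c * k : ℕ) - (n : ℝ) / (d * k : ℕ)) : ℂ)) =
      -(χ (-1) * (d * k * (M / 2))) * ∑ l ∈ Finset.Icc 1 (c * k),
        (star χ) (l : ZMod k) * charE (M - 1) (star χ) (((d : ℤ) : ℝ) * l / c) *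
          (periodicB m ((l : ℝ) / ((c : ℝ) * k)) : ℂ) := by
  have hk : k ≠ 0 := NeZero.ne k
  have hkR : (k : ℝ) ≠ 0 := Nat.cast_ne_zero.mpr hk
  have hcR : (c : ℝ) ≠ 0 := Nat.cast_ne_zero.mpr hc
  rw [Finset.sum_comm]
  have hper : Function.Periodic (fun l : ℕ => ∑ n ∈ Finset.range (d * k),
        ((-1) ^ n * χ (n : ZMod k)) * (star χ) (l : ZMod k) *
          ((periodicB m ((l : ℝ) / (c * k : ℕ)) : ℂ) *
            (periodicB M ((l : ℝ) / (c * k : ℕ) - (n : ℝ) / (d * k : ℕ)) : ℂ))) (c * k) := by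
    intro l
    refine Finset.sum_congr rfl fun n _ => ?_
    have h1 := character_natCast_periodic (star χ) (dvd_mul_left k c) l
    have h2 := periodicB_div_add_periodic m (mul_ne_zero hc hk) 0 l
    have h3 := periodicB_div_add_periodic M (mul_ne_zero hc hk) (-((n : ℝ) / (d * k : ℕ))) l
    simp only [add_zero, ← sub_eq_add_neg] at h1 h2 h3
    rw [h1, h2, h3]
  rw [← sum_Icc_of_periodic hper, Finset.mul_sum, Finset.mul_sum]
  refine Finset.sum_congr rfl fun l _ => ?_
  by_cases hl : (star χ) (l : ZMod k) = 0
  · simp [hl]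
  have hl' := character_ne_zero_of_star_ne_zero hl
  have h := charE_eq_sum hk2 χ hd hdeven M ((l : ℝ) / (c * k : ℕ))
    fun j hj => fract_add_div_ne_zero hne hc hcop hcd hj hl'
  have hneg := sum_range_alternating_neg χ hd hdeven M ((l : ℝ) / (c * k : ℕ))
  have e1 : (d : ℝ) * k * ((l : ℝ) / (c * k : ℕ)) = ((d : ℤ) : ℝ) * l / c := by
    push_cast; field_simp
  have e2 : ((c : ℝ) * k) = (c * k : ℕ) := by push_cast; rfl
  rw [e1] at h
  rw [e2]
  calc _ = (star χ) (l : ZMod k) * (periodicB m ((l : ℝ) / (c * k : ℕ)) : ℂ) *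
      (((d : ℂ) * k) ^ M * ∑ n ∈ Finset.range (d * k), (-1) ^ n * χ (n : ZMod k) *
        (periodicB M ((l : ℝ) / (c * k : ℕ) - (n : ℝ) / (d * k : ℕ)) : ℂ)) := by
        simp only [Finset.mul_sum]
        exact Finset.sum_congr rfl fun n _ => by ring
    _ = (star χ) (l : ZMod k) * (periodicB m ((l : ℝ) / (c * k : ℕ)) : ℂ) * χ (-1) *
      (-(d * k * (M / 2)) * charE (M - 1) (star χ) (((d : ℤ) : ℝ) * l / c)) := by
        rw [hneg, ← h]; ring
    _ = _ := by ring

theorem sum_periodicB_mul_eq {k : ℕ} [NeZero k] (hk2 : Odd k) {χ : DirichletCharacter ℂ k}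
    (hne : χ ≠ 1) {c d : ℕ} (hc : c ≠ 0) (hd : d ≠ 0) (hdeven : Even d) (m M : ℕ) :
    ((d : ℂ) * k) ^ m * ((c : ℂ) * k) ^ M *
      ∑ n ∈ Finset.range (d * k), ∑ l ∈ Finset.range (c * k),
        ((-1) ^ n * χ (n : ZMod k)) * (star χ) (l : ZMod k) *
          ((periodicB m ((n : ℝ) / (d * k : ℕ)) : ℂ) *
            (periodicB M ((l : ℝ) / (c * k : ℕ)) : ℂ)) =
      -(d * k * (m / 2)) * (c * k) * (charB M χ 0 * charE (m - 1) (star χ) 0) := by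
  have h1 := charB_eq_sum χ hc M 0
  have h2 := charE_eq_sum hk2 χ hd hdeven m 0 fun j hj => by
    simpa using fract_div_ne_zero hne one_ne_zero hj
  simp only [mul_zero, neg_zero, add_zero, sub_zero] at h1 h2
  calc _ = (((d : ℂ) * k) ^ m * ∑ n ∈ Finset.range (d * k),
        (-1) ^ n * χ (n : ZMod k) * (periodicB m ((n : ℝ) / (d * k : ℕ)) : ℂ)) *
      (((c : ℂ) * k) ^ M * ∑ l ∈ Finset.range (c * k),
        (star χ) (l : ZMod k) * (periodicB M ((l : ℝ) / (c * k : ℕ)) : ℂ)) := by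
        rw [mul_mul_mul_comm, Finset.sum_mul_sum]
        congr 1
        exact Finset.sum_congr rfl fun n _ => Finset.sum_congr rfl fun l _ => by ring
    _ = _ := by rw [h1, h2]; ring

theorem charB_zero {k : ℕ} [NeZero k] {χ : DirichletCharacter ℂ k} (hne : χ ≠ 1) (x : ℝ) :
    charB 0 χ x = 0 := by
  have h := sum_range_natCast_zmod fun a : ZMod k => (star χ) a
  rw [MulChar.sum_eq_zero_of_ne_one (star_ne_one hne)] at h
  have h0 : ∀ x : ℝ, (periodicB 0 x : ℂ) = 1 := fun x => by simp [periodicB]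
  simp only [charB, h0, mul_one, h, mul_zero]

theorem sum_range_add_two_eq_sum_Icc {f : ℕ → ℂ} {p : ℕ} (h0 : f 0 = 0) (hp : f (p + 1) = 0) :
    ∑ m ∈ Finset.range (p + 1 + 1), f m = ∑ m ∈ Finset.Icc 1 p, f m := by
  rw [Finset.sum_range_succ, hp, add_zero, Finset.sum_range_succ', h0, add_zero,
    Finset.range_eq_Ico, Finset.sum_Ico_add' f 0 p 1]
  rfl

/-! ### Assembling the reciprocity relation -/

/-- The polynomial in `z` whose value at `z ≠ 0` is `z^{p-1} g₁(c, d, -1/z, p, χ)`. -/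
noncomputable def g₁Poly {k : ℕ} (c d p : ℕ) (χ : DirichletCharacter ℂ k) : Polynomial ℂ :=
  ∑ m ∈ Finset.Icc 1 p,
    Polynomial.C ((p.choose m : ℂ) * (k : ℂ) ^ ((m : ℤ) - p) *
      ∑ n ∈ Finset.Icc 1 (c * k),
        χ (n : ZMod k) * charE (p - m) χ (((d : ℤ) : ℝ) * n / c) *
          (periodicB m ((n : ℝ) / ((c : ℝ) * k)) : ℂ)) *
      (Polynomial.C (c : ℂ) - Polynomial.C (d : ℂ) * Polynomial.X) ^ (m - 1) *
      Polynomial.X ^ (p - m)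

theorem eval_g₁Poly {k : ℕ} (c d p : ℕ) (χ : DirichletCharacter ℂ k) (z : ℂ) :
    (g₁Poly c d p χ).eval z = ∑ m ∈ Finset.Icc 1 p,
      ((p.choose m : ℂ) * (k : ℂ) ^ ((m : ℤ) - p) *
      ∑ n ∈ Finset.Icc 1 (c * k),
        χ (n : ZMod k) * charE (p - m) χ (((d : ℤ) : ℝ) * n / c) *
          (periodicB m ((n : ℝ) / ((c : ℝ) * k)) : ℂ)) * (c - d * z) ^ (m - 1) * z ^ (p - m) := by
  rw [g₁Poly, Polynomial.eval_finsetSum]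
  refine Finset.sum_congr rfl fun m _ => ?_
  simp only [Polynomial.eval_mul, Polynomial.eval_C, Polynomial.eval_pow, Polynomial.eval_sub,
    Polynomial.eval_X]

theorem eval_g₁Poly_eq {k : ℕ} (c d p : ℕ) (χ : DirichletCharacter ℂ k) {z : ℂ} (hz : z ≠ 0) :
    (g₁Poly c d p χ).eval z = z ^ (p - 1) * g₁ c (d : ℤ) (-1 / z) p χ := by
  rw [eval_g₁Poly, g₁, Finset.mul_sum]
  refine Finset.sum_congr rfl fun m hm => ?_
  obtain ⟨hm1, hmp⟩ := Finset.mem_Icc.mp hm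
  have e : (c - d * z : ℂ) = z * -(c * (-1 / z) + (d : ℤ)) := by
    push_cast; field_simp; ring
  have e2 : p - 1 = (m - 1) + (p - m) := by omega
  rw [e, mul_pow, e2, pow_add]
  ring

/-- The summed three-term relation. -/
theorem double_character_sum_three_term {k : ℕ} [NeZero k] {χ : DirichletCharacter ℂ k}
    (hne : χ ≠ 1) {c d : ℕ} (hc : c ≠ 0) (hd : d ≠ 0) (hcop : Nat.Coprime c d)
    (hcd : k ∣ d ∨ k ∣ c) {P Q D : ℂ} (hP : P ≠ 0) (hQ : Q ≠ 0) (hD : D ≠ 0)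
    (hPQD : P = Q + D) (N : ℕ) :
    D * ∑ m ∈ Finset.range (N + 1), (N.choose m : ℂ) * P ^ m * Q ^ (N - m) *
        ∑ n ∈ Finset.range (d * k), ∑ l ∈ Finset.range (c * k),
          ((-1) ^ n * χ (n : ZMod k)) * (star χ) (l : ZMod k) *
            ((periodicB m ((n : ℝ) / (d * k : ℕ)) : ℂ) *
              (periodicB (N - m) ((l : ℝ) / (c * k : ℕ) - (n : ℝ) / (d * k : ℕ)) : ℂ)) +
      Q * ∑ m ∈ Finset.range (N + 1), (N.choose m : ℂ) * P ^ m * (-D) ^ (N - m) *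
        ∑ n ∈ Finset.range (d * k), ∑ l ∈ Finset.range (c * k),
          ((-1) ^ n * χ (n : ZMod k)) * (star χ) (l : ZMod k) *
            ((periodicB m ((l : ℝ) / (c * k : ℕ)) : ℂ) *
              (periodicB (N - m) ((l : ℝ) / (c * k : ℕ) - (n : ℝ) / (d * k : ℕ)) : ℂ)) =
      P * ∑ m ∈ Finset.range (N + 1), (N.choose m : ℂ) * D ^ m * Q ^ (N - m) *
        ∑ n ∈ Finset.range (d * k), ∑ l ∈ Finset.range (c * k),
          ((-1) ^ n * χ (n : ZMod k)) * (star χ) (l : ZMod k) *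
            ((periodicB m ((n : ℝ) / (d * k : ℕ)) : ℂ) *
              (periodicB (N - m) ((l : ℝ) / (c * k : ℕ)) : ℂ)) := by
  have swap : ∀ (R U V : ℂ) (w : ℕ → ℕ → ℂ) (f g : ℕ → ℕ → ℕ → ℂ),
      R * ∑ m ∈ Finset.range (N + 1), (N.choose m : ℂ) * U ^ m * V ^ (N - m) *
        ∑ n ∈ Finset.range (d * k), ∑ l ∈ Finset.range (c * k),
          w n l * (f m n l * g (N - m) n l) =
      ∑ n ∈ Finset.range (d * k), ∑ l ∈ Finset.range (c * k), w n l *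
        (R * ∑ m ∈ Finset.range (N + 1), (N.choose m : ℂ) *
          (f m n l * U ^ m * (g (N - m) n l * V ^ (N - m)))) := by
    intro R U V w f g
    simp only [Finset.mul_sum]
    rw [Finset.sum_comm]
    refine Finset.sum_congr rfl fun n _ => ?_
    rw [Finset.sum_comm]
    refine Finset.sum_congr rfl fun l _ => Finset.sum_congr rfl fun m _ => ?_
    ring
  rw [swap D P Q (fun n l => ((-1) ^ n * χ (n : ZMod k)) * (star χ) (l : ZMod k))
      (fun m n _ => (periodicB m ((n : ℝ) / (d * k : ℕ)) : ℂ))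
      (fun m n l => (periodicB m ((l : ℝ) / (c * k : ℕ) - (n : ℝ) / (d * k : ℕ)) : ℂ)),
    swap Q P (-D) (fun n l => ((-1) ^ n * χ (n : ZMod k)) * (star χ) (l : ZMod k))
      (fun m _ l => (periodicB m ((l : ℝ) / (c * k : ℕ)) : ℂ))
      (fun m n l => (periodicB m ((l : ℝ) / (c * k : ℕ) - (n : ℝ) / (d * k : ℕ)) : ℂ)),
    swap P D Q (fun n l => ((-1) ^ n * χ (n : ZMod k)) * (star χ) (l : ZMod k))
      (fun m n _ => (periodicB m ((n : ℝ) / (d * k : ℕ)) : ℂ))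
      (fun m _ l => (periodicB m ((l : ℝ) / (c * k : ℕ)) : ℂ)), ← Finset.sum_add_distrib]
  refine Finset.sum_congr rfl fun n _ => ?_
  rw [← Finset.sum_add_distrib]
  refine Finset.sum_congr rfl fun l _ => ?_
  -- Pairs of weight zero are discarded first: only for the others is non-integrality known.
  by_cases hn : χ (n : ZMod k) = 0
  · simp [hn]
  by_cases hl : (star χ) (l : ZMod k) = 0
  · simp only [hl, mul_zero, zero_mul, add_zero]
  have hl' := character_ne_zero_of_star_ne_zero hl
  rw [← mul_add, periodicB_three_term (fract_div_ne_zero hne hd hn) (fract_div_ne_zero hne hc hl')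
    (fract_sub_div_ne_zero hne hc hd hcop hcd hn hl') hP hQ hD hPQD N]

theorem reciprocity_of_ne {k : ℕ} (hk : Odd k) {χ : DirichletCharacter ℂ k} (hne : χ ≠ 1)
    {p : ℕ} (hp : 1 ≤ p) {c d : ℕ} (hc : c ≠ 0) (hd : d ≠ 0) (hcop : Nat.Coprime c d)
    (hdeven : Even d) (hcd : k ∣ d ∨ k ∣ c) {z : ℂ} (hz : z ≠ 0) (ha : (c : ℂ) - d * z ≠ 0) :
    ((p : ℂ) + 1) / 2 * (g₁Poly c d p (star χ)).eval z + χ (-1) * g₂ d (-(c : ℤ)) z p χ =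
      reciprocityRHS z p χ := by
  have hk0 : k ≠ 0 := hk.pos.ne'
  have : NeZero k := ⟨hk0⟩
  have hkC : (k : ℂ) ≠ 0 := Nat.cast_ne_zero.mpr hk0
  have hcC : (c : ℂ) ≠ 0 := Nat.cast_ne_zero.mpr hc
  have hdC : (d : ℂ) ≠ 0 := Nat.cast_ne_zero.mpr hd
  have hD : -((d : ℂ) * z) ≠ 0 := neg_ne_zero.mpr (mul_ne_zero hdC hz)
  have hmaster := double_character_sum_three_term hne hc hd hcop hcd ha hcC hD
    (sub_eq_add_neg _ _) (p + 1)
  have hzero := double_character_sum_eq_zero hne hc hd hcop hdeven hcd (p + 1)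
  have hB0 : ∀ x : ℝ, (periodicB 0 x : ℂ) = 1 := fun x => by simp [periodicB]
  have hT1 := sum_periodicB_sub_mul_eq χ hc hd hdeven
  have hT2 := sum_periodicB_mul_sub_eq hk hne hc hd hcop hdeven hcd
  have hT3 := sum_periodicB_mul_eq hk hne hc hd hdeven
  -- The terms m = 0 and m = p + 1 drop out of all three sums, through
  -- `double_character_sum_eq_zero`, through 𝔅_{0,χ} = 0, or through the index factor accompanying
  -- 𝓔.
  rw [sum_range_add_two_eq_sum_Icc, sum_range_add_two_eq_sum_Icc,
    sum_range_add_two_eq_sum_Icc] at hmaster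
  rotate_left
  · have h := hT3 0 (p + 1)
    simp only [pow_zero, one_mul, Nat.cast_zero, zero_div, mul_zero, neg_zero, zero_mul] at h
    rw [Nat.sub_zero, (mul_eq_zero.mp h).resolve_left (pow_ne_zero _ (mul_ne_zero hcC hkC)),
      mul_zero]
  · have h := hT3 (p + 1) 0
    rw [charB_zero hne, zero_mul, mul_zero, pow_zero, mul_one] at h
    rw [Nat.sub_self, (mul_eq_zero.mp h).resolve_left (pow_ne_zero _ (mul_ne_zero hdC hkC)),
      mul_zero]
  · simp only [hB0, one_mul, Nat.sub_zero, hzero, mul_zero]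
  · have h := hT2 (p + 1) 0
    simp only [pow_zero, one_mul, Nat.cast_zero, zero_div, mul_zero, neg_zero, zero_mul] at h
    rw [Nat.sub_self, h, mul_zero]
  · simp only [hB0, one_mul, Nat.sub_zero, hzero, mul_zero]
  · have h := hT1 (p + 1) 0
    simp only [charB_zero hne, zero_mul, mul_zero, pow_zero, one_mul, Finset.sum_const_zero] at h
    rw [Nat.sub_self, h, mul_zero]
  set a : ℂ := (c : ℂ) - d * z with ha_def
  have hχ : χ (-1) * χ (-1) = 1 := by rw [← map_mul]; simp
  have hS1 : ∑ m ∈ Finset.Icc 1 p, ((p + 1).choose m : ℂ) * a ^ m * (c : ℂ) ^ (p + 1 - m) *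
      ∑ n ∈ Finset.range (d * k), ∑ l ∈ Finset.range (c * k),
        ((-1) ^ n * χ (n : ZMod k)) * (star χ) (l : ZMod k) *
          ((periodicB m ((n : ℝ) / (d * k : ℕ)) : ℂ) * (periodicB (p + 1 - m)
            ((l : ℝ) / (c * k : ℕ) - (n : ℝ) / (d * k : ℕ)) : ℂ)) =
      a * c * g₂ d (-(c : ℤ)) z p χ := by
    rw [g₂, Finset.mul_sum]
    refine Finset.sum_congr rfl fun m hm => ?_
    obtain ⟨hm1, hmp⟩ := Finset.mem_Icc.mp hm
    have h := hT1 m (p + 1 - m)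
    have hkpow : (k : ℂ) ^ ((m : ℤ) - p) * k ^ (p + 1 - m) = k := by
      rw [← zpow_natCast, ← zpow_add₀ hkC, Nat.cast_sub (by omega)]
      push_cast
      rw [show (m : ℤ) - p + (p + 1 - m) = 1 by ring, zpow_one]
    have e : -((d : ℂ) * z + ((-(c : ℤ) : ℤ) : ℂ)) = a := by rw [ha_def]; push_cast; ring
    have hpow : a ^ m = a * a ^ (m - 1) := by rw [← pow_succ', Nat.sub_add_cancel hm1]
    rw [e, hpow]
    apply mul_left_cancel₀ (pow_ne_zero (p + 1 - m) hkC)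
    rw [mul_pow] at h
    linear_combination ((p + 1).choose m : ℂ) * a * a ^ (m - 1) * h -
      ((p + 1).choose m : ℂ) * a * a ^ (m - 1) * c * (∑ n ∈ Finset.Icc 1 (d * k),
        (-1) ^ n * χ (n : ZMod k) * charB (p + 1 - m) χ (((-(c : ℤ) : ℤ) : ℝ) * n / d) *
          (periodicB m ((n : ℝ) / ((d : ℝ) * k)) : ℂ)) * hkpow
  have hS2 : ∑ m ∈ Finset.Icc 1 p, ((p + 1).choose m : ℂ) * a ^ m *
      (- -((d : ℂ) * z)) ^ (p + 1 - m) *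
      ∑ n ∈ Finset.range (d * k), ∑ l ∈ Finset.range (c * k),
        ((-1) ^ n * χ (n : ZMod k)) * (star χ) (l : ZMod k) *
          ((periodicB m ((l : ℝ) / (c * k : ℕ)) : ℂ) * (periodicB (p + 1 - m)
            ((l : ℝ) / (c * k : ℕ) - (n : ℝ) / (d * k : ℕ)) : ℂ)) =
      -(χ (-1) * a * d * z * ((p + 1) / 2)) * (g₁Poly c d p (star χ)).eval z := by
    rw [eval_g₁Poly, Finset.mul_sum]
    refine Finset.sum_congr rfl fun m hm => ?_
    obtain ⟨hm1, hmp⟩ := Finset.mem_Icc.mp hm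
    have h := hT2 m (p + 1 - m)
    have hkpow : (k : ℂ) ^ ((m : ℤ) - p) * k ^ (p + 1 - m) = k := by
      rw [← zpow_natCast, ← zpow_add₀ hkC, Nat.cast_sub (by omega)]
      push_cast
      rw [show (m : ℤ) - p + (p + 1 - m) = 1 by ring, zpow_one]
    have hpow : a ^ m = a * a ^ (m - 1) := by rw [← pow_succ', Nat.sub_add_cancel hm1]
    have hzpow : z ^ (p + 1 - m) = z * z ^ (p - m) := by
      rw [← pow_succ']; congr 1; omega
    -- The factor p + 1 - m from the alternating relation turns C(p+1,m) into (p+1)C(p,m), the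
    -- origin of the coefficient (p+1)/2.
    have hchoose : ((p + 1).choose m : ℂ) * ((p + 1 - m : ℕ) : ℂ) = (p + 1) * p.choose m := by
      have h2 := Nat.add_one_mul_choose_eq p (p - m)
      rw [Nat.choose_symm hmp, show p - m + 1 = p + 1 - m by omega,
        Nat.choose_symm (show m ≤ p + 1 by omega)] at h2
      exact_mod_cast h2.symm
    rw [show p + 1 - m - 1 = p - m by omega] at h
    rw [neg_neg, mul_pow, hzpow, hpow]
    apply mul_left_cancel₀ (pow_ne_zero (p + 1 - m) hkC)
    rw [mul_pow] at h
    set G := ∑ l ∈ Finset.Icc 1 (c * k),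
        (star χ) (l : ZMod k) * charE (p - m) (star χ) (((d : ℤ) : ℝ) * l / c) *
          (periodicB m ((l : ℝ) / ((c : ℝ) * k)) : ℂ)
    linear_combination ((p + 1).choose m : ℂ) * a * a ^ (m - 1) * z * z ^ (p - m) * h -
      a * a ^ (m - 1) * z * z ^ (p - m) * χ (-1) * d * k / 2 * G * hchoose +
      a * a ^ (m - 1) * z * z ^ (p - m) * χ (-1) * d * ((p + 1) / 2) * p.choose m * G * hkpow
  have hS3 : χ (-1) * ∑ m ∈ Finset.Icc 1 p, ((p + 1).choose m : ℂ) * (-((d : ℂ) * z)) ^ m *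
      (c : ℂ) ^ (p + 1 - m) *
      ∑ n ∈ Finset.range (d * k), ∑ l ∈ Finset.range (c * k),
        ((-1) ^ n * χ (n : ZMod k)) * (star χ) (l : ZMod k) *
          ((periodicB m ((n : ℝ) / (d * k : ℕ)) : ℂ) *
            (periodicB (p + 1 - m) ((l : ℝ) / (c * k : ℕ)) : ℂ)) =
      -(c * d * z) * reciprocityRHS z p χ := by
    rw [reciprocityRHS, Finset.mul_sum, Finset.mul_sum, Finset.mul_sum]
    refine Finset.sum_congr rfl fun m hm => ?_
    obtain ⟨hm1, hmp⟩ := Finset.mem_Icc.mp hm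
    have h := hT3 m (p + 1 - m)
    have hkpow : (k : ℂ) ^ m * k ^ (p + 1 - m) = k ^ (p - 1) * k * k := by
      rw [← pow_add, ← pow_succ, ← pow_succ]; congr 1; omega
    have hzpow : (-z) ^ m = -z * (-z) ^ (m - 1) := by rw [← pow_succ', Nat.sub_add_cancel hm1]
    rw [show -((d : ℂ) * z) = d * -z by ring, mul_pow, hzpow]
    rw [mul_pow, mul_pow] at h
    set S := ∑ n ∈ Finset.range (d * k), ∑ l ∈ Finset.range (c * k),
        ((-1) ^ n * χ (n : ZMod k)) * (star χ) (l : ZMod k) *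
          ((periodicB m ((n : ℝ) / (d * k : ℕ)) : ℂ) *
            (periodicB (p + 1 - m) ((l : ℝ) / (c * k : ℕ)) : ℂ))
    set R := charB (p + 1 - m) χ 0 * charE (m - 1) (star χ) 0 with hR
    have h' : (k : ℂ) ^ (p - 1) * ((d : ℂ) ^ m * c ^ (p + 1 - m) * S) = -(d * (m / 2)) * c * R := by
      apply mul_left_cancel₀ (mul_ne_zero hkC hkC)
      linear_combination h - (d : ℂ) ^ m * c ^ (p + 1 - m) * S * hkpow
    have hkp := pow_ne_zero (p - 1) hkC
    have h'' : (d : ℂ) ^ m * c ^ (p + 1 - m) * S = -(d * (m / 2)) * c * R / k ^ (p - 1) := by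
      rw [eq_div_iff hkp, ← h']; ring
    rw [hR] at h''
    linear_combination χ (-1) * ((p + 1).choose m : ℂ) * (-z * (-z) ^ (m - 1)) * h''
  rw [hS1, hS2] at hmaster
  have hne0 : a * c * d * z ≠ 0 := mul_ne_zero (mul_ne_zero (mul_ne_zero ha hcC) hdC) hz
  apply mul_left_cancel₀ hne0
  linear_combination -χ (-1) * hmaster - a * hS3 -
    a * c * d * z * ((p + 1) / 2) * (g₁Poly c d p (star χ)).eval z * hχ

theorem continuous_g₂ {k : ℕ} (c : ℕ) (d : ℤ) (p : ℕ) (χ : DirichletCharacter ℂ k) :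
    Continuous fun z => g₂ c d z p χ := by
  unfold g₂
  fun_prop

theorem continuous_reciprocityRHS {k : ℕ} (p : ℕ) (χ : DirichletCharacter ℂ k) :
    Continuous fun z => reciprocityRHS z p χ := by
  unfold reciprocityRHS
  fun_prop

theorem reciprocity {k : ℕ} (hk : Odd k) {χ : DirichletCharacter ℂ k} (hne : χ ≠ 1)
    {p : ℕ} (hp : 1 ≤ p) {c d : ℕ} (hc : c ≠ 0) (hd : d ≠ 0) (hcop : Nat.Coprime c d)
    (hdeven : Even d) (hcd : k ∣ d ∨ k ∣ c) (z : ℂ) :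
    ((p : ℂ) + 1) / 2 * (g₁Poly c d p (star χ)).eval z + χ (-1) * g₂ d (-(c : ℤ)) z p χ =
      reciprocityRHS z p χ := by
  have hdC : (d : ℂ) ≠ 0 := Nat.cast_ne_zero.mpr hd
  -- The excluded points are the zeros of D = -dz and P = c - dz, by which the argument divides.
  have hdense : Dense ({0, (c : ℂ) / d}ᶜ : Set ℂ) :=
    (Set.toFinite _).countable.dense_compl ℝ
  have hleft : Continuous fun z => ((p : ℂ) + 1) / 2 * (g₁Poly c d p (star χ)).eval z +
      χ (-1) * g₂ d (-(c : ℤ)) z p χ :=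
    (continuous_const.mul (Polynomial.continuous _)).add
      (continuous_const.mul (continuous_g₂ _ _ _ _))
  refine congrFun (hleft.ext_on hdense (continuous_reciprocityRHS p χ) fun w hw => ?_) z
  simp only [Set.mem_compl_iff, Set.mem_insert_iff, Set.mem_singleton_iff, not_or] at hw
  refine reciprocity_of_ne hk hne hp hc hd hcop hdeven hcd hw.1 fun h => hw.2 ?_
  rw [eq_div_iff hdC]
  linear_combination -h

end CharHardyBerndt

theorem mainTheorem7 {k : ℕ} (hk : Odd k) (χ : DirichletCharacter ℂ k)
    (hprim : χ.IsPrimitive) (hne : χ ≠ 1)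
    (p : ℕ) (hp : 1 ≤ p) (c d : ℕ) (hc : 0 < c) (hd : 0 < d) (hcop : Nat.Coprime c d)
    (hdeven : Even d) (hcd : k ∣ d ∨ k ∣ c) :
    (∀ z : ℂ, z ≠ 0 →
      ((p : ℂ) + 1) / 2 * z ^ (p - 1) * CharHardyBerndt.g₁ c (d : ℤ) (-1 / z) p (star χ) +
          χ (-1) * CharHardyBerndt.g₂ d (-(c : ℤ)) z p χ =
        CharHardyBerndt.reciprocityRHS z p χ) ∧
    ∃ P : Polynomial ℂ,
      (∀ z : ℂ, z ≠ 0 →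
        P.eval z = z ^ (p - 1) * CharHardyBerndt.g₁ c (d : ℤ) (-1 / z) p (star χ)) ∧
      ∀ z : ℂ,
        ((p : ℂ) + 1) / 2 * P.eval z + χ (-1) * CharHardyBerndt.g₂ d (-(c : ℤ)) z p χ =
          CharHardyBerndt.reciprocityRHS z p χ := by
  have hrec := CharHardyBerndt.reciprocity hk hne hp hc.ne' hd.ne' hcop hdeven hcd
  have hP := fun (z : ℂ) (hz : z ≠ 0) => CharHardyBerndt.eval_g₁Poly_eq c d p (star χ) hz
  refine ⟨fun z hz => ?_, CharHardyBerndt.g₁Poly c d p (star χ), hP, hrec⟩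
  rw [mul_assoc, ← hP z hz]
  exact hrec z
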